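/- Let $\mathcal V$ be a complex vector space of finite dimension $p$ and let $W$ be a complex reflection group acting on $\mathcal V$, that is, a finite group of linear automorphisms of $\mathcal V$ generated by reflections (automorphisms of finite order whose fixed space is a hyperplane). Let $\omega=(\omega_1,\dots,\omega_p)\colon\mathcal V\to\mathbb C^p$ be the orbit map of $W$: its coordinate functions $\omega_i$ are homogeneous polynomials that generate the algebra of $W$-invariant polynomials on $\mathcal V$. Let $h\colon\mathcal X\hookrightarrow\mathcal V$ be a holomorphic embedding of a connected $n$-dimensional complex manifold, let $\mathcal Y=h(\mathcal X)\subseteq\mathcal V$ be the resulting complex submanifold, and let $f=\omega|_{\mathcal Y}\colon\mathcal Y\to\mathbb C^p$ (equivalently $f=\omega\circ h\colon\mathcal X\to\mathbb C^p$) be the associated reflection mapping. Put $$W^{\mathcal Y}=\{\sigma\in W\mid \sigma\mathcal Y=\mathcal Y\},\qquad W_{\mathcal Y}=\{\sigma\in W\mid \sigma u=u\text{ for all }u\in\mathcal Y\}.$$ Suppose that $f\colon\mathcal Y\to f(\mathcal Y)$ is proper and that $f(\mathcal Y)$ is irreducible, i.e. it is not the union of two analytic subsets of $f(\mathcal Y)$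 both different from $f(\mathcal Y)$. Then the degree of $f$ is the index $|W^{\mathcal Y}:W_{\mathcal Y}|$; that is, there is an open dense subset $U\subseteq f(\mathcal Y)$ such that every $z\in U$ has exactly $|W^{\mathcal Y}:W_{\mathcal Y}|$ preimages in $\mathcal Y$. -/

import Mathlib

open scoped Pointwise Manifold ContDiff

/-! ### Complex reflection groups and their orbit maps -/

/-- A (complex, or pseudo-) reflection of a complex vector space: a linear automorphism of
finite order whose fixed space is a hyperplane. -/
def IsComplexReflection {V : Type*} [AddCommGroup V] [Module ℂ V] (σ : V ≃ₗ[ℂ] V) : Prop :=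
  IsOfFinOrder σ ∧
    Module.finrank ℂ (LinearMap.ker ((σ : V →ₗ[ℂ] V) - LinearMap.id)) + 1 = Module.finrank ℂ V

/-- A complex reflection group: a finite group of linear automorphisms generated by the
reflections it contains. -/
structure IsComplexReflectionGroup {V : Type*} [AddCommGroup V] [Module ℂ V]
    (W : Subgroup (V ≃ₗ[ℂ] V)) : Prop where
  finite : Finite W
  closure_reflections : Subgroup.closure {σ | σ ∈ W ∧ IsComplexReflection σ} = W

/-- The algebra of polynomial functions on `V`, generated by the linear forms. -/
def polynomialFunctionAlgebra (V : Type*) [AddCommGroup V] [Module ℂ V] : Subalgebra ℂ (V → ℂ) :=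
  Algebra.adjoin ℂ (Set.range fun l : Module.Dual ℂ V => (l : V → ℂ))

/-- The algebra of `W`-invariant polynomial functions on `V`. -/
def invariantPolynomialAlgebra {V : Type*} [AddCommGroup V] [Module ℂ V]
    (W : Subgroup (V ≃ₗ[ℂ] V)) : Subalgebra ℂ (V → ℂ) where
  carrier := {F | F ∈ polynomialFunctionAlgebra V ∧ ∀ σ ∈ W, ∀ u, F (σ u) = F u}
  mul_mem' := by
    rintro F G ⟨hF, hF'⟩ ⟨hG, hG'⟩
    exact ⟨mul_mem hF hG, fun σ hσ u => by simp [hF' σ hσ u, hG' σ hσ u]⟩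
  add_mem' := by
    rintro F G ⟨hF, hF'⟩ ⟨hG, hG'⟩
    exact ⟨add_mem hF hG, fun σ hσ u => by simp [hF' σ hσ u, hG' σ hσ u]⟩
  algebraMap_mem' := fun c => ⟨Subalgebra.algebraMap_mem _ c, fun _ _ _ => rfl⟩

/-- `q : V → ℂ^p`, with `p = dim V`, is an orbit map of `W`: its coordinate functions are
homogeneous polynomials that generate the algebra of `W`-invariant polynomials. -/
structure IsOrbitMap {V : Type*} [AddCommGroup V] [Module ℂ V]
    (W : Subgroup (V ≃ₗ[ℂ] V)) (q : V → Fin (Module.finrank ℂ V) → ℂ) : Prop where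
  homogeneous : ∀ i, ∃ d : ℕ, ∀ (c : ℂ) (u : V), q (c • u) i = c ^ d * q u i
  adjoin_eq : Algebra.adjoin ℂ (Set.range fun i => fun u => q u i) =
    invariantPolynomialAlgebra W

/-! ### Irreducible analytic sets and the degree of a map -/

/-- `A` is an analytic subset of `Z`: near every point of `Z`, it is the set of points of `Z`
at which finitely many holomorphic functions vanish. -/
def IsAnalyticSubsetOf {E : Type*} [NormedAddCommGroup E] [NormedSpace ℂ E]
    (Z A : Set E) : Prop :=
  A ⊆ Z ∧ ∀ z ∈ Z, ∃ U : Set E, IsOpen U ∧ z ∈ U ∧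
    ∃ (m : ℕ) (g : Fin m → E → ℂ), (∀ i, AnalyticOnNhd ℂ (g i) U) ∧
      A ∩ U = {u | u ∈ Z ∩ U ∧ ∀ i, g i u = 0}

/-- `Z` is irreducible: it is non-empty, and not the union of two proper analytic subsets. -/
def IsAnalyticallyIrreducible {E : Type*} [NormedAddCommGroup E] [NormedSpace ℂ E]
    (Z : Set E) : Prop :=
  Z.Nonempty ∧ ∀ A B : Set E, IsAnalyticSubsetOf Z A → IsAnalyticSubsetOf Z B →
    A ∪ B = Z → A = Z ∨ B = Z

/-- `f` has degree `d`: a generic point of the image of `f` (that is, every point of some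
open dense subset of the image) has exactly `d` preimages. -/
def HasGenericDegree {X E : Type*} [TopologicalSpace E] (f : X → E) (d : ℕ) : Prop :=
  ∃ U : Set (Set.range f), IsOpen U ∧ Dense U ∧ ∀ z ∈ U, (f ⁻¹' {(z : E)}).encard = d

/-- The degree is unique. -/
theorem HasGenericDegree.unique {X E : Type*} [TopologicalSpace E] [Nonempty X]
    {f : X → E} {d d' : ℕ} (h : HasGenericDegree f d) (h' : HasGenericDegree f d') :
    d = d' := by
  obtain ⟨U, hU, hUd, hUc⟩ := h
  obtain ⟨U', hU', hUd', hUc'⟩ := h'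
  have : Nonempty (Set.range f) := (Set.range_nonempty f).to_subtype
  obtain ⟨z, hz, hz'⟩ := (hUd.inter_of_isOpen_left hUd' hU).nonempty
  have := (hUc z hz).symm.trans (hUc' z hz')
  exact_mod_cast this

open Set Filter Topology

/-! Since `W` is finite, invariant polynomials separate its orbits, so the fibre of `q ∘ h` through
`x` corresponds to the points of the orbit of `h x` lying in the range of `h`. For generic `x`, only
elements stabilizing the range keep `h x` in it, and only elements fixing the range pointwise fix `h
x`; orbit-stabilizer then gives the index. Each exceptional condition on `x` is closed (for
membership in the range, by properness) and locally analytic, so the identity theorem on the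
connected `X` makes it nowhere dense. There are finitely many, their union is saturated, and `q ∘ h`
is closed onto its image, so a dense open set of values remains. -/

/-! ### Polynomial functions -/

/-- A polynomial function separates any two disjoint finite sets. -/
theorem exists_polynomialFunction_eq_zero_eq_one {V : Type*} [AddCommGroup V] [Module ℂ V]
    (A B : Finset V) (hAB : Disjoint A B) :
    ∃ F ∈ polynomialFunctionAlgebra V, (∀ a ∈ A, F a = 0) ∧ ∀ b ∈ B, F b = 1 := by
  have sep : ∀ a b : V, ∃ e ∈ polynomialFunctionAlgebra V, a ≠ b → e a = 0 ∧ e b = 1 := by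
    intro a b
    by_cases hab : a = b
    · exact ⟨0, zero_mem _, fun h => absurd hab h⟩
    obtain ⟨l, hl⟩ : ∃ l : Module.Dual ℂ V, l (b - a) ≠ 0 := by
      by_contra! H
      exact hab (sub_eq_zero.mp ((Module.forall_dual_apply_eq_zero_iff ℂ _).mp H)).symm
    refine ⟨(l (b - a))⁻¹ • ((l : V → ℂ) - algebraMap ℂ (V → ℂ) (l a)),
      Subalgebra.smul_mem _ (sub_mem (Algebra.subset_adjoin (mem_range_self l))
        (Subalgebra.algebraMap_mem _ _)) _, fun _ => ⟨?_, ?_⟩⟩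
    · simp
    · have : l b - l a = l (b - a) := (map_sub l b a).symm
      simp only [Pi.smul_apply, Pi.sub_apply, Pi.algebraMap_apply, Algebra.algebraMap_self,
        RingHom.id_apply, this, smul_eq_mul]
      exact inv_mul_cancel₀ hl
  choose e he he' using sep
  -- The inner product vanishes on `A` and is 1 at `b`; the outer one is therefore 1 on `A` and 0 on
  -- `B`.
  refine ⟨1 - ∏ b ∈ B, (1 - ∏ a ∈ A, e a b),
    sub_mem (one_mem _) (prod_mem fun b _ => sub_mem (one_mem _) (prod_mem fun a _ => he a b)),
    fun a ha => ?_, fun b hb => ?_⟩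
  · have : ∀ b ∈ B, (1 - ∏ a ∈ A, e a b) a = 1 := by
      intro b hb
      have hab : a ≠ b := fun h => Finset.disjoint_left.mp hAB ha (h ▸ hb)
      rw [Pi.sub_apply, Finset.prod_apply, Finset.prod_eq_zero (f := fun c => e c b a) ha (he' a b hab).1]
      simp
    rw [Pi.sub_apply, Finset.prod_apply, Finset.prod_congr rfl this]
    simp
  · have h1 : (1 - ∏ a ∈ A, e a b) b = 0 := by
      rw [Pi.sub_apply, Finset.prod_apply, Finset.prod_congr rfl
        fun a ha => (he' a b fun h => Finset.disjoint_left.mp hAB ha (h ▸ hb)).2]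
      simp
    rw [Pi.sub_apply, Finset.prod_apply, Finset.prod_eq_zero (f := fun c => (1 - ∏ a ∈ A, e a c) b) hb h1]
    simp

/-- Polynomial functions are stable under linear substitutions. -/
theorem comp_mem_polynomialFunctionAlgebra {V : Type*} [AddCommGroup V] [Module ℂ V]
    {F : V → ℂ} (hF : F ∈ polynomialFunctionAlgebra V) (σ : V →ₗ[ℂ] V) :
    (fun u => F (σ u)) ∈ polynomialFunctionAlgebra V := by
  induction hF using Algebra.adjoin_induction with
  | mem F hF =>
    obtain ⟨l, rfl⟩ := hF
    exact Algebra.subset_adjoin ⟨l.comp σ, rfl⟩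
  | algebraMap c => exact Subalgebra.algebraMap_mem _ c
  | add F G _ _ hF hG => exact add_mem hF hG
  | mul F G _ _ hF hG => exact mul_mem hF hG

/-- Polynomial functions on a finite-dimensional space are continuous. -/
theorem continuous_of_mem_polynomialFunctionAlgebra {V : Type*} [NormedAddCommGroup V]
    [NormedSpace ℂ V] [FiniteDimensional ℂ V] {F : V → ℂ}
    (hF : F ∈ polynomialFunctionAlgebra V) : Continuous F := by
  induction hF using Algebra.adjoin_induction with
  | mem F hF =>
    obtain ⟨l, rfl⟩ := hF
    exact LinearMap.continuous_of_finiteDimensional l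
  | algebraMap c => exact continuous_const
  | add F G _ _ hF hG => exact hF.add hG
  | mul F G _ _ hF hG => exact hF.mul hG

/-! ### Fibres of the orbit map -/

namespace IsOrbitMap

theorem coord_mem {V : Type*} [AddCommGroup V] [Module ℂ V] {W : Subgroup (V ≃ₗ[ℂ] V)}
    {q : V → Fin (Module.finrank ℂ V) → ℂ} (hq : IsOrbitMap W q) (i) :
    (fun u => q u i) ∈ invariantPolynomialAlgebra W :=
  hq.adjoin_eq ▸ Algebra.subset_adjoin ⟨i, rfl⟩

theorem map_apply {V : Type*} [AddCommGroup V] [Module ℂ V] {W : Subgroup (V ≃ₗ[ℂ] V)}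
    {q : V → Fin (Module.finrank ℂ V) → ℂ} (hq : IsOrbitMap W q) (σ : W) (u : V) :
    q (σ • u) = q u :=
  funext fun i => (hq.coord_mem i).2 σ σ.2 u

theorem continuous {V : Type*} [NormedAddCommGroup V] [NormedSpace ℂ V] [FiniteDimensional ℂ V]
    {W : Subgroup (V ≃ₗ[ℂ] V)} {q : V → Fin (Module.finrank ℂ V) → ℂ} (hq : IsOrbitMap W q) :
    Continuous q :=
  continuous_pi fun i => continuous_of_mem_polynomialFunctionAlgebra (hq.coord_mem i).1

/-- The fibres of the orbit map of a finite group are the orbits. -/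
theorem exists_smul_eq {V : Type*} [AddCommGroup V] [Module ℂ V] {W : Subgroup (V ≃ₗ[ℂ] V)}
    [Finite W] {q : V → Fin (Module.finrank ℂ V) → ℂ} (hq : IsOrbitMap W q) {u v : V}
    (huv : q u = q v) : ∃ σ : W, σ • u = v := by
  classical
  have := Fintype.ofFinite W
  by_contra! H
  obtain ⟨F, hF, hFu, hFv⟩ := exists_polynomialFunction_eq_zero_eq_one
    (Finset.univ.image fun σ : W => σ • u) (Finset.univ.image fun σ : W => σ • v) (by
      rw [Finset.disjoint_left]
      simp only [Finset.mem_image, Finset.mem_univ, true_and]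
      rintro _ ⟨σ, rfl⟩ ⟨τ, h⟩
      exact H (τ⁻¹ * σ) (by rw [mul_smul, ← h, inv_smul_smul]))
  have key : ∀ G ∈ invariantPolynomialAlgebra W, G u = G v := by
    intro G hG
    rw [← hq.adjoin_eq] at hG
    induction hG using Algebra.adjoin_induction with
    | mem G hG =>
      obtain ⟨i, rfl⟩ := hG
      exact congrFun huv i
    | algebraMap c => rfl
    | add F G _ _ hF hG => simp [hF, hG]
    | mul F G _ _ hF hG => simp [hF, hG]
  -- The multiplicative norm of `F` is invariant, 0 at `u` (factor `τ = 1`) and 1 at `v`.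
  have := key (fun x => ∏ τ : W, F (τ • x)) ⟨?_, ?_⟩
  · rw [Finset.prod_eq_zero (Finset.mem_univ (1 : W))
      (hFu _ (Finset.mem_image_of_mem (fun σ : W => σ • u) (Finset.mem_univ 1))),
      Finset.prod_eq_one fun τ _ =>
        hFv _ (Finset.mem_image_of_mem (fun σ : W => σ • v) (Finset.mem_univ τ))] at this
    exact zero_ne_one this
  · have h := prod_mem (S := polynomialFunctionAlgebra V) (t := Finset.univ)
      (f := fun τ : W => fun x => F (τ • x)) fun τ _ =>
        comp_mem_polynomialFunctionAlgebra hF ((τ : V ≃ₗ[ℂ] V) : V →ₗ[ℂ] V)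
    convert h using 1
    ext x
    simp
  · intro σ hσ x
    refine Fintype.prod_equiv (Equiv.mulRight (⟨σ, hσ⟩ : W)) _ _ fun τ => ?_
    simp only [Equiv.coe_mulRight, mul_smul]
    rfl

end IsOrbitMap

/-! ### Local equations and the identity theorem -/

/-- Near each of its points, an embedded analytic submanifold is the zero set of an
analytic map. -/
theorem Manifold.IsSmoothEmbedding.exists_local_equation.{u} {E : Type*} {V : Type u} [NormedAddCommGroup E]
    [NormedSpace ℂ E] [NormedAddCommGroup V] [NormedSpace ℂ V] {X : Type*} [TopologicalSpace X]
    [ChartedSpace E X] {h : X → V}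
    (hh : Manifold.IsSmoothEmbedding 𝓘(ℂ, E) 𝓘(ℂ, V) ω h) (x : X) :
    ∃ (F : Type u) (_ : NormedAddCommGroup F) (_ : NormedSpace ℂ F) (O : Set V) (g : V → F),
      IsOpen O ∧ h x ∈ O ∧ ContDiffOn ℂ ω g O ∧ ∀ v ∈ O, v ∈ range h ↔ g v = 0 := by
  have hx := hh.isImmersion.isImmersionAt x
  set φ := hx.domChart with hφ
  set ψ := hx.codChart with hψ
  set e := hx.equiv with he
  have hxφ : x ∈ φ.source := hx.mem_domChart_source
  have hsrc : φ.source ⊆ h ⁻¹' ψ.source := hx.source_subset_preimage_source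
  have hwr : ∀ a ∈ φ.target, ψ (h (φ.symm a)) = e (a, 0) := by
    intro a ha
    have := hx.writtenInCharts (show a ∈ (φ.extend 𝓘(ℂ, E)).target by simpa using ha)
    simpa using this
  -- The embedding property keeps other sheets of the range out of `O`.
  obtain ⟨O, hO, hOφ⟩ := hh.isEmbedding.isOpen_iff.mp φ.open_source
  have hψc : ContinuousOn (fun v => e.symm (ψ v)) ψ.source :=
    e.symm.continuous.comp_continuousOn ψ.continuousOn
  -- In these charts `h` reads `a ↦ (a, 0)`, so the second component is the equation.
  refine ⟨hx.complement, inferInstance, inferInstance,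
    (ψ.source ∩ (fun v => e.symm (ψ v)) ⁻¹' (Prod.fst ⁻¹' φ.target)) ∩ O,
    fun v => (e.symm (ψ v)).2, (hψc.isOpen_inter_preimage ψ.open_source
      (φ.open_target.preimage continuous_fst)).inter hO, ⟨⟨hsrc hxφ, ?_⟩, ?_⟩, ?_, ?_⟩
  · have := hwr (φ x) (φ.map_source hxφ)
    rw [φ.left_inv hxφ] at this
    simp [this, φ.map_source hxφ]
  · change x ∈ h ⁻¹' O
    rwa [hOφ]
  · have h1 : ContDiffOn ℂ ω ψ ψ.source :=
      (contMDiffOn_of_mem_maximalAtlas hx.codChart_mem_maximalAtlas).contDiffOn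
    exact (contDiff_snd.comp e.symm.contDiff).comp_contDiffOn
      (h1.mono fun v hv => hv.1.1)
  · rintro v ⟨⟨hv, hvφ⟩, hvO⟩
    constructor
    · rintro ⟨y, rfl⟩
      have hy : y ∈ φ.source := by rwa [← hOφ]
      have := hwr (φ y) (φ.map_source hy)
      rw [φ.left_inv hy] at this
      simp [this]
    · intro hv0
      set a := (e.symm (ψ v)).1 with ha
      have hav : e (a, 0) = ψ v := by
        rw [← e.apply_symm_apply (ψ v)]
        exact congrArg e (Prod.ext rfl hv0.symm)
      refine ⟨φ.symm a, ψ.injOn (hsrc (φ.map_target hvφ)) hv ?_⟩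
      rw [hwr a hvφ, hav]

/-- The identity theorem: a closed subset of a connected analytic manifold which is locally the
zero set of an analytic map is everything or has empty interior. -/
theorem eq_univ_or_interior_eq_empty_of_local_equations {E : Type*} [NormedAddCommGroup E]
    [NormedSpace ℂ E] {X : Type*} [TopologicalSpace X] [ChartedSpace E X]
    [IsManifold 𝓘(ℂ, E) ω X] [PreconnectedSpace X] {S : Set X} (hS : IsClosed S)
    (hloc : ∀ x ∈ S, ∃ (F : Type*) (_ : NormedAddCommGroup F) (_ : NormedSpace ℂ F)
      (N : Set X) (g : X → F), IsOpen N ∧ x ∈ N ∧ ContMDiffOn 𝓘(ℂ, E) 𝓘(ℂ, F) ω g N ∧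
        ∀ y ∈ N, y ∈ S ↔ g y = 0) :
    S = univ ∨ interior S = ∅ := by
  -- On a chart ball around a limit point of the interior, the equation vanishes near some point,
  -- hence on the whole ball.
  have hcl : IsClosed (interior S) := by
    refine isClosed_of_closure_subset fun x hx => ?_
    obtain ⟨F, _, _, N, g, hN, hxN, hg, hgS⟩ :=
      hloc x (hS.closure_subset_iff.mpr interior_subset hx)
    set φ := chartAt E x
    have hxφ : x ∈ φ.source := mem_chart_source E x
    have hT : IsOpen (φ.target ∩ φ.symm ⁻¹' N) := φ.isOpen_inter_preimage_symm hN
    have hgφ : ContDiffOn ℂ ω (g ∘ φ.symm) (φ.target ∩ φ.symm ⁻¹' N) :=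
      (hg.comp (contMDiffOn_chart_symm.mono inter_subset_left) fun a ha => ha.2).contDiffOn
    obtain ⟨r, hr, hrT⟩ := Metric.isOpen_iff.mp hT (φ x)
      ⟨φ.map_source hxφ, by simpa [φ.left_inv hxφ] using hxN⟩
    have han : AnalyticOnNhd ℂ (g ∘ φ.symm) (Metric.ball (φ x) r) :=
      (Metric.isOpen_ball.analyticOn_iff_analyticOnNhd).mp (hgφ.mono hrT).analyticOn
    have hO : IsOpen (φ.source ∩ φ ⁻¹' Metric.ball (φ x) r) :=
      φ.isOpen_inter_preimage Metric.isOpen_ball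
    have hxO : x ∈ φ.source ∩ φ ⁻¹' Metric.ball (φ x) r := ⟨hxφ, Metric.mem_ball_self hr⟩
    obtain ⟨y, ⟨hyφ, hyr⟩, hyS⟩ := mem_closure_iff.mp hx _ hO hxO
    have hev : g ∘ φ.symm =ᶠ[𝓝 (φ y)] 0 := by
      have h1 : φ.target ∩ φ.symm ⁻¹' (N ∩ interior S) ∈ 𝓝 (φ y) := by
        refine (φ.isOpen_inter_preimage_symm (hN.inter isOpen_interior)).mem_nhds
          ⟨φ.map_source hyφ, ?_⟩
        have := (hrT hyr).2
        rw [mem_preimage, φ.left_inv hyφ] at this ⊢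
        exact ⟨this, hyS⟩
      filter_upwards [h1] with a ha
      exact (hgS _ ha.2.1).mp (interior_subset ha.2.2)
    have hzero := han.eqOn_zero_of_preconnected_of_eventuallyEq_zero
      (convex_ball (φ x) r).isPreconnected hyr hev
    refine mem_interior.mpr ⟨_, ?_, hO, hxO⟩
    rintro z ⟨hzφ, hzr⟩
    have hz := hzero hzr
    have hzN := (hrT hzr).2
    simp only [Function.comp_apply, mem_preimage, φ.left_inv hzφ] at hz hzN
    exact (hgS z hzN).mpr hz
  rcases isClopen_iff.mp ⟨hcl, isOpen_interior⟩ with h | h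
  · exact Or.inr h
  · exact Or.inl (univ_subset_iff.mp (h ▸ interior_subset))

/-! ### Properness and generic fibres -/

/-- If the composition of an embedding `h` with an invariant map `q` is proper onto its image,
then the points which a symmetry `σ` keeps in the range of `h` form a closed set. -/
theorem isClosed_setOf_mem_range_of_isProperMap {X V E : Type*} [TopologicalSpace X]
    [TopologicalSpace V] [T2Space V] [TopologicalSpace E] {h : X → V} {q : V → E} {σ : V → V}
    (hh : Continuous h) (hσ : Continuous σ) (hqσ : ∀ u, q (σ u) = q u)
    (hproper : IsProperMap (rangeFactorization (q ∘ h))) : IsClosed {x | σ (h x) ∈ range h} := by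
  refine isClosed_iff_ultrafilter.mpr fun x 𝒱 hx hS => ?_
  have : Nonempty X := ⟨x⟩
  choose! t ht using fun (y : X) (hy : σ (h y) ∈ range h) => hy
  have ht' : ∀ᶠ y in 𝒱, h (t y) = σ (h y) := mem_of_superset hS ht
  -- By invariance `t y` and `y` have the same value, so properness yields a limit of `t` along `𝒱`.
  have hlim : Tendsto (rangeFactorization (q ∘ h)) (𝒱.map t)
      (𝓝 (rangeFactorization (q ∘ h) x)) := by
    refine tendsto_map'_iff.mpr (Tendsto.congr' ?_ ((hproper.continuous.tendsto x).mono_left hx))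
    filter_upwards [ht'] with y hy
    exact Subtype.ext (by simp [hy, hqσ])
  obtain ⟨x', -, hx'⟩ := (isProperMap_iff_ultrafilter.mp hproper).2 hlim
  refine ⟨x', tendsto_nhds_unique (f := fun y => h (t y)) (l := (𝒱 : Filter X))
    ((hh.tendsto x').comp hx') ?_⟩
  exact Tendsto.congr' (ht'.mono fun _ h => h.symm) (((hσ.comp hh).tendsto x).mono_left hx)

/-- A finite union of closed sets with empty interior has empty interior. -/
theorem interior_iUnion_eq_empty_of_finite {X ι : Type*} [TopologicalSpace X] [Finite ι]
    {S : ι → Set X} (hS : ∀ i, IsClosed (S i)) (hS' : ∀ i, interior (S i) = ∅) :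
    interior (⋃ i, S i) = ∅ := by
  have : ∀ s : Set ι, s.Finite → interior (⋃ i ∈ s, S i) = ∅ := by
    intro s hs
    induction s, hs using Set.Finite.induction_on with
    | empty => simp
    | insert _ _ ih =>
      rw [biUnion_insert, interior_union_isClosed_of_interior_empty (hS _) ih, hS']
  simpa using this univ finite_univ

/-- A map has generic degree `d` if its fibres have `d` points outside a saturated closed set
with empty interior. -/
theorem HasGenericDegree.of_isClosedMap {X E : Type*} [TopologicalSpace X] [TopologicalSpace E]
    {f : X → E} {d : ℕ} (hf : Continuous f) (hcl : IsClosedMap (rangeFactorization f))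
    {B : Set X} (hB : IsClosed B) (hB' : interior B = ∅) (hsat : ∀ x ∈ B, ∀ y, f y = f x → y ∈ B)
    (hd : ∀ x ∉ B, (f ⁻¹' {f x}).encard = d) : HasGenericDegree f d := by
  -- Saturation turns the complement of the image into the image of a dense set.
  have hU : (rangeFactorization f '' B)ᶜ = rangeFactorization f '' Bᶜ := by
    ext ⟨_, x, rfl⟩
    constructor
    · exact fun hx => ⟨x, fun hxB => hx ⟨x, hxB, rfl⟩, rfl⟩
    · rintro ⟨y, hy, hyx⟩ ⟨z, hz, hzx⟩
      exact hy (hsat z hz y (congrArg Subtype.val (hyx.trans hzx.symm)))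
  refine ⟨(rangeFactorization f '' B)ᶜ, (hcl B hB).isOpen_compl, ?_, ?_⟩
  · rw [hU]
    exact rangeFactorization_surjective.denseRange.dense_image hf.rangeFactorization
      (interior_eq_empty_iff_dense_compl.mp hB')
  · rw [hU]
    rintro _ ⟨x, hx, rfl⟩
    exact hd x hx

/-- A group element of finite order which maps a set into itself stabilizes it. -/
theorem smul_set_eq_of_smul_set_subset {G α : Type*} [Group G] [Finite G] [MulAction G α] {g : G}
    {s : Set α} (h : g • s ⊆ s) : g • s = s := by
  have hpow : ∀ k : ℕ, g ^ k • s ⊆ s := by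
    intro k
    induction k with
    | zero => simp
    | succ k ih =>
      rw [pow_succ, mul_smul]
      exact (smul_set_mono h).trans ih
  refine h.antisymm ?_
  rw [subset_smul_set_iff]
  -- This power is `g⁻¹`.
  have := hpow (orderOf g - 1)
  rwa [← inv_eq_of_mul_eq_one_right (by
    rw [← pow_succ', Nat.sub_add_cancel (orderOf_pos g), pow_orderOf_eq_one] :
      g * g ^ (orderOf g - 1) = 1)] at this

/-! ### The degree formula -/

theorem proposition2p4 {V : Type*} [NormedAddCommGroup V] [NormedSpace ℂ V]
    [FiniteDimensional ℂ V]
    (W : Subgroup (V ≃ₗ[ℂ] V)) (hW : IsComplexReflectionGroup W)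
    (q : V → Fin (Module.finrank ℂ V) → ℂ) (hq : IsOrbitMap W q)
    (n : ℕ) {X : Type*} [TopologicalSpace X] [ChartedSpace (EuclideanSpace ℂ (Fin n)) X]
    [IsManifold 𝓘(ℂ, EuclideanSpace ℂ (Fin n)) ω X] [ConnectedSpace X]
    (h : X → V)
    (hh : Manifold.IsSmoothEmbedding 𝓘(ℂ, EuclideanSpace ℂ (Fin n)) 𝓘(ℂ, V) ω h)
    (hproper : IsProperMap (Set.rangeFactorization (q ∘ h)))
    (hirr : IsAnalyticallyIrreducible (Set.range (q ∘ h))) :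
    HasGenericDegree (q ∘ h)
      ((fixingSubgroup W (Set.range h)).relIndex
        (MulAction.stabilizer W (Set.range h))) := by
  have := hW.finite
  have hinj : Function.Injective h := hh.isEmbedding.injective
  have hcont : Continuous h := hh.isEmbedding.continuous
  have hσ : ∀ σ : W, ContDiff ℂ ω fun u : V => σ • u := fun σ =>
    (LinearMap.toContinuousLinearMap ((σ : V ≃ₗ[ℂ] V) : V →ₗ[ℂ] V)).contDiff
  have hσh : ∀ σ : W, ContMDiff 𝓘(ℂ, EuclideanSpace ℂ (Fin n)) 𝓘(ℂ, V) ω fun x => σ • h x :=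
    fun σ => (hσ σ).contMDiff.comp hh.contMDiff
  have hfix : ∀ σ : W, σ ∈ fixingSubgroup W (range h) ↔ ∀ x, σ • h x = h x := fun σ => by
    simp [mem_fixingSubgroup_iff]
  have hstab : ∀ σ : W, σ ∈ MulAction.stabilizer W (range h) ↔ ∀ x, σ • h x ∈ range h :=
    fun σ => by
      rw [MulAction.mem_stabilizer_iff]
      refine ⟨fun H x => H ▸ smul_mem_smul_set (mem_range_self x), fun H => ?_⟩
      refine smul_set_eq_of_smul_set_subset ?_
      rintro _ ⟨_, ⟨x, rfl⟩, rfl⟩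
      exact H x
  let S : W → Set X := fun σ => {x | σ • h x ∈ range h}
  let T : W → Set X := fun σ => {x | σ • h x = h x}
  have hScl : ∀ σ, IsClosed (S σ) := fun σ =>
    isClosed_setOf_mem_range_of_isProperMap hcont (hσ σ).continuous
      (hq.map_apply σ) hproper
  have hTcl : ∀ σ, IsClosed (T σ) := fun σ => isClosed_eq (hσh σ).continuous hcont
  have hSint : ∀ σ, σ ∉ MulAction.stabilizer W (range h) → interior (S σ) = ∅ := by
    intro σ hσn
    refine (eq_univ_or_interior_eq_empty_of_local_equations
      (E := EuclideanSpace ℂ (Fin n)) (hScl σ) ?_).resolve_left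
      fun H => hσn ((hstab σ).mpr fun x => (H ▸ mem_univ x : x ∈ S σ))
    -- Pull back by `σ ∘ h` the local equation of the range at `h y = σ • h x`.
    rintro x ⟨y, hy⟩
    obtain ⟨F, _, _, O, g, hO, hyO, hg, hgO⟩ := hh.exists_local_equation y
    refine ⟨F, inferInstance, inferInstance, (fun x => σ • h x) ⁻¹' O, fun x => g (σ • h x),
      hO.preimage (hσh σ).continuous, ?_, ?_, fun z hz => hgO _ hz⟩
    · rwa [mem_preimage, ← hy]
    · exact hg.contMDiffOn.comp (hσh σ).contMDiffOn fun _ hz => hz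
  have hTint : ∀ σ, σ ∉ fixingSubgroup W (range h) → interior (T σ) = ∅ := by
    intro σ hσn
    refine (eq_univ_or_interior_eq_empty_of_local_equations
      (E := EuclideanSpace ℂ (Fin n)) (hTcl σ) fun x _ =>
      ⟨V, inferInstance, inferInstance, univ, fun x => σ • h x - h x, isOpen_univ, mem_univ x,
        ((hσh σ).sub hh.contMDiff).contMDiffOn, fun z _ => sub_eq_zero.symm⟩).resolve_left
      fun H => hσn ((hfix σ).mpr fun x => (H ▸ mem_univ x : x ∈ T σ))
  let B : Set X := (⋃ σ : {σ // σ ∉ MulAction.stabilizer W (range h)}, S σ) ∪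
    ⋃ σ : {σ // σ ∉ fixingSubgroup W (range h)}, T σ
  have hSB : ∀ {x}, x ∉ B → ∀ σ : W, σ • h x ∈ range h →
      σ ∈ MulAction.stabilizer W (range h) := fun hx σ hσx => by
    by_contra hσn
    exact hx (Or.inl (mem_iUnion.mpr ⟨⟨σ, hσn⟩, hσx⟩))
  have hTB : ∀ {x}, x ∉ B → ∀ σ : W, σ • h x = h x → σ ∈ fixingSubgroup W (range h) :=
    fun hx σ hσx => by
      by_contra hσn
      exact hx (Or.inr (mem_iUnion.mpr ⟨⟨σ, hσn⟩, hσx⟩))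
  have hScl' : IsClosed (⋃ σ : {σ // σ ∉ MulAction.stabilizer W (range h)}, S σ) :=
    isClosed_iUnion_of_finite fun σ => hScl σ.1
  have hTcl' : IsClosed (⋃ σ : {σ // σ ∉ fixingSubgroup W (range h)}, T σ) :=
    isClosed_iUnion_of_finite fun σ => hTcl σ.1
  refine HasGenericDegree.of_isClosedMap (B := B) (hq.continuous.comp hcont) hproper.isClosedMap
    (hScl'.union hTcl') ?_ ?_ ?_
  · have hSint' := interior_iUnion_eq_empty_of_finite
      (S := fun σ : {σ // σ ∉ MulAction.stabilizer W (range h)} => S σ)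
      (fun σ => hScl σ) fun σ => hSint σ σ.2
    have hTint' := interior_iUnion_eq_empty_of_finite
      (S := fun σ : {σ // σ ∉ fixingSubgroup W (range h)} => T σ)
      (fun σ => hTcl σ) fun σ => hTint σ σ.2
    rw [interior_union_isClosed_of_interior_empty hScl' hTint', hSint']
  -- If `x ∉ B`, then `h b = σ • h x` with `σ` in the stabilizer. A bad `τ` at `b` would give a bad
  -- `τ * σ`, or a bad conjugate `σ⁻¹ * τ * σ`, at `x`.
  · intro b hb x hxb
    by_contra hx
    obtain ⟨σ, hσ⟩ := hq.exists_smul_eq hxb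
    have hσs := hSB hx σ (hσ ▸ mem_range_self b)
    rcases hb with hb | hb
    · obtain ⟨⟨τ, hτ⟩, hτb⟩ := mem_iUnion.mp hb
      have hτb : τ • h b ∈ range h := hτb
      rw [← hσ, ← mul_smul] at hτb
      exact hτ ((Subgroup.mul_mem_cancel_right _ hσs).mp (hSB hx _ hτb))
    · obtain ⟨⟨τ, hτ⟩, hτb⟩ := mem_iUnion.mp hb
      have hτb : τ • h b = h b := hτb
      have hfx := (hfix _).mp (hTB hx (σ⁻¹ * τ * σ) (by
        rw [mul_smul, mul_smul, hσ, hτb, ← hσ, inv_smul_smul]))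
      refine hτ ((hfix τ).mpr fun z => ?_)
      obtain ⟨y, hy⟩ := (hstab _).mp (inv_mem hσs) z
      have := hfx y
      rwa [hy, mul_smul, mul_smul, smul_inv_smul, smul_left_cancel_iff] at this
  · intro x hx
    have himg : h '' ((q ∘ h) ⁻¹' {(q ∘ h) x}) =
        MulAction.orbit (MulAction.stabilizer W (range h)) (h x) := by
      ext v
      constructor
      · rintro ⟨y, hy, rfl⟩
        obtain ⟨σ, hσ⟩ := hq.exists_smul_eq (Eq.symm hy)
        exact ⟨⟨σ, hSB hx σ (hσ ▸ mem_range_self y)⟩, hσ⟩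
      · rintro ⟨⟨σ, hσ⟩, rfl⟩
        obtain ⟨y, hy⟩ := (hstab σ).mp hσ x
        exact ⟨y, (congrArg q hy).trans (hq.map_apply σ _), hy⟩
    have hgrp : (fixingSubgroup W (range h)).subgroupOf (MulAction.stabilizer W (range h)) =
        MulAction.stabilizer (MulAction.stabilizer W (range h)) (h x) := by
      ext ⟨σ, hσ⟩
      rw [Subgroup.mem_subgroupOf, MulAction.mem_stabilizer_iff]
      exact ⟨fun H => (hfix σ).mp H x, fun H => hTB hx σ H⟩
    have hfin : (MulAction.orbit (MulAction.stabilizer W (range h)) (h x)).Finite :=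
      Set.finite_range _
    rw [← hinj.encard_image, himg, Subgroup.relIndex, hgrp, MulAction.index_stabilizer,
      hfin.cast_ncard_eq]
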